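/- For a topological space $X$, let $\Delta(X)$ be the smallest cardinality of a nonempty open subset of $X$, and let $\widehat{s}(X)$ be the smallest uncountable cardinal $\kappa$ such that $X$ has no discrete subset of cardinality $\kappa$ (a subset is discrete if its subspace topology is discrete). The space $X$ is called maximally resolvable if it contains $\Delta(X)$ many pairwise disjoint dense subsets. The following two set-theoretic assumptions are equivalent: (a) for every infinite cardinal $\kappa$ the power $2^\kappa$ is a finite successor of $\kappa$, that is, $2^\kappa=\kappa^{+n}$ for some $n\in\mathbb{N}$, where $\kappa^{+n}$ is the $n$-th iterated successor cardinal of $\kappa$; (b) every singular cardinal is a strong limit cardinal. If they hold, then every Hausdorff space $X$ with $\Delta(X)\ge\widehat{s}(X)$ is maximally resolvable. -/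

import Mathlib

open Cardinal

universe u

/-- A space is `κ`-resolvable if it has `κ` many pairwise disjoint dense subsets. -/
def IsResolvable (X : Type u) [TopologicalSpace X] (κ : Cardinal.{u}) : Prop :=
  ∃ 𝒟 : Set (Set X), #𝒟 = κ ∧ (∀ D ∈ 𝒟, Dense D) ∧ 𝒟.PairwiseDisjoint id

/-- The dispersion character `Δ(X)`: the smallest cardinality of a nonempty open set.
For `X` nonempty the infimum is over a nonempty class, hence attained. -/
noncomputable def dispersionCharacter (X : Type u) [TopologicalSpace X] : Cardinal.{u} :=
  sInf {c | ∃ G : Set X, IsOpen G ∧ G.Nonempty ∧ #G = c}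

/-- A space is maximally resolvable if it is `Δ(X)`-resolvable. -/
def IsMaximallyResolvable (X : Type u) [TopologicalSpace X] : Prop :=
  IsResolvable X (dispersionCharacter X)

/-- `ŝ(X)`: the smallest uncountable cardinal `κ` such that `X` has no discrete subset
(that is, no subset whose subspace topology is discrete) of cardinality `κ`. -/
noncomputable def hatSpread (X : Type u) [TopologicalSpace X] : Cardinal.{u} :=
  sInf {κ | ℵ₀ < κ ∧ ∀ D : Set X, IsDiscrete D → #D ≠ κ}

/-- The infimum defining `ŝ(X)` is a minimum. -/
theorem hatSpread_mem (X : Type u) [TopologicalSpace X] :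
    ℵ₀ < hatSpread X ∧ ∀ D : Set X, IsDiscrete D → #D ≠ hatSpread X := by
  refine csInf_mem (s := {κ | ℵ₀ < κ ∧ ∀ D : Set X, IsDiscrete D → #D ≠ κ})
    ⟨Order.succ (max ℵ₀ #X), ?_, fun D _ => ne_of_lt ?_⟩
  · exact Order.lt_succ_of_le (le_max_left _ _)
  · exact Order.lt_succ_of_le ((mk_set_le D).trans (le_max_right _ _))

/-- The infimum defining `Δ(X)` is a minimum for nonempty `X`. -/
theorem dispersionCharacter_mem (X : Type u) [TopologicalSpace X] [Nonempty X] :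
    ∃ G : Set X, IsOpen G ∧ G.Nonempty ∧ #G = dispersionCharacter X :=
  csInf_mem (s := {c | ∃ G : Set X, IsOpen G ∧ G.Nonempty ∧ #G = c})
    ⟨#(Set.univ : Set X), Set.univ, isOpen_univ, Set.univ_nonempty, rfl⟩

/-! The limit of the cardinals `κ⁺ⁿ` is singular. If it is a strong limit it exceeds `2 ^ κ`, which
is thus some `κ⁺ⁿ`. Conversely, if powers are finite successors, they stay below every singular
cardinal, since it is a limit cardinal.

For resolvability it suffices to find, inside each nonempty open set, a subspace with enough
disjoint dense sets (`hasDisjointDense_univ_of_forall_isOpen`). Shrink the open set to some `V` of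
least size `κ = #V`. Then all nonempty open subsets of `V` have size `κ`, and `V` has no discrete
subset of size `κ`. A Hausdorff space of singular strong limit size `κ` does have one
(`exists_isDiscrete_of_isSingular`), so `κ` is regular.

For regular `κ` there are two cases. If every subspace has a dense subset of size `< κ`, disjoint
dense sets are removed one after another. Otherwise `V` contains a left-separated sequence of length
`κ`, where `κ⁺` almost disjoint sets of size `κ`, with their complete accumulation points, yield the
dense sets (`exists_hasDisjointDense_of_leftSeparated`). -/

namespace MaxResolvable

open Set Topology Function

/-- All transfinite constructions below use this. A step must be solvable for an arbitrary `f`, so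
what is known of earlier values has to enter `P` as a premise. -/
theorem exists_greedy {ι X : Type*} [LinearOrder ι] [WellFoundedLT ι]
    (P : ∀ a : ι, (Iio a → X) → X → Prop) (h : ∀ a f, ∃ x, P a f x) :
    ∃ f : ι → X, ∀ a, P a (fun b => f b) (f a) := by
  classical
  choose g hg using h
  let F : ∀ a : ι, (∀ b, b < a → X) → X := fun a r => g a fun b => r b b.2
  refine ⟨WellFoundedLT.fix F, fun a => ?_⟩
  rw [WellFoundedLT.fix_eq F a]
  exact hg a _

theorem isDiscrete_of_forall_nhds {X : Type*} [TopologicalSpace X] {s : Set X}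
    (h : ∀ x ∈ s, ∃ U ∈ 𝓝 x, ∀ y ∈ s, y ∈ U → y = x) : IsDiscrete s := by
  rw [isDiscrete_iff_forall_mem_exists_isOpen]
  intro x hx
  obtain ⟨U, hU, hUs⟩ := h x hx
  obtain ⟨V, hVU, hV, hxV⟩ := mem_nhds_iff.1 hU
  refine ⟨V, hV, ?_⟩
  ext y
  constructor
  · rintro ⟨hy, hys⟩
    exact hUs y hys (hVU hy)
  · rintro rfl
    exact ⟨hxV, hx⟩

theorem isDiscrete_image {X Z : Type*} [TopologicalSpace X] [TopologicalSpace Z] {D : Set X}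
    (hD : IsDiscrete D) {f : X → Z} (hf : IsEmbedding f) : IsDiscrete (f '' D) := by
  refine isDiscrete_of_forall_nhds ?_
  rintro _ ⟨a, ha, rfl⟩
  obtain ⟨V, hV, hVD⟩ := (isDiscrete_iff_forall_mem_exists_isOpen.1 hD) a ha
  have haV : V ∈ 𝓝 a := hV.mem_nhds (hVD.ge rfl).1
  rw [hf.nhds_eq_comap] at haV
  obtain ⟨U, hU, hUV⟩ := haV
  refine ⟨U, hU, ?_⟩
  rintro _ ⟨b, hb, rfl⟩ hbU
  exact congrArg f (hVD.le ⟨hUV hbU, hb⟩)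

/-- Points of a sequence with neighbourhoods that miss all other terms form a discrete set. -/
theorem isDiscrete_range_of_forall_nhds {ι : Type*} {X : Type*} [TopologicalSpace X] {f : ι → X}
    (h : ∀ a, ∃ U ∈ 𝓝 (f a), ∀ b, b ≠ a → f b ∉ U) : IsDiscrete (range f) ∧ Injective f := by
  refine ⟨isDiscrete_of_forall_nhds ?_, fun a b hab => ?_⟩
  · rintro _ ⟨a, rfl⟩
    obtain ⟨U, hU, hUa⟩ := h a
    refine ⟨U, hU, ?_⟩
    rintro _ ⟨b, rfl⟩ hb
    by_contra hne
    exact hUa b (fun hba => hne (hba ▸ rfl)) hb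
  · by_contra hne
    obtain ⟨U, hU, hUa⟩ := h a
    exact hUa b (Ne.symm hne) (hab ▸ mem_of_mem_nhds hU)

/-! ### Families of disjoint dense sets. -/

/-- `Y` has a family of pairwise disjoint subsets, indexed by `ι`, that are dense in `Y`. -/
def HasDisjointDense {X : Type*} [TopologicalSpace X] (Y : Set X) (ι : Type*) : Prop :=
  ∃ D : ι → Set X, Pairwise (Disjoint on D) ∧ ∀ i, D i ⊆ Y ∧ Y ⊆ closure (D i)

theorem HasDisjointDense.comp {X : Type*} [TopologicalSpace X] {Y : Set X} {ι ι' : Type*}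
    (h : HasDisjointDense Y ι) (e : ι' ↪ ι) : HasDisjointDense Y ι' := by
  obtain ⟨D, hD, hY⟩ := h
  exact ⟨fun i => D (e i), fun i j hij => hD (e.injective.ne hij), fun i => hY _⟩

theorem HasDisjointDense.image {X Z : Type*} [TopologicalSpace X] [TopologicalSpace Z] {Y : Set X}
    {ι : Type*} (h : HasDisjointDense Y ι) {f : X → Z} (hf : IsEmbedding f) :
    HasDisjointDense (f '' Y) ι := by
  obtain ⟨D, hD, hY⟩ := h
  refine ⟨fun i => f '' D i, fun i j hij => disjoint_image_of_injective hf.injective (hD hij),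
    fun i => ⟨image_mono (hY i).1, ?_⟩⟩
  rintro _ ⟨x, hx, rfl⟩
  have := (hY i).2 hx
  rwa [hf.closure_eq_preimage_closure_image] at this

/-- If every nonempty open set contains a nonempty subspace with `ι` many disjoint dense subsets,
then so has the whole space. -/
theorem hasDisjointDense_univ_of_forall_isOpen {X ι : Type*} [TopologicalSpace X]
    (h : ∀ U : Set X, IsOpen U → U.Nonempty → ∃ Y ⊆ U, Y.Nonempty ∧ HasDisjointDense Y ι) :
    HasDisjointDense (univ : Set X) ι := by
  classical
  -- A maximal disjoint family of such subspaces has dense union, and their `i`-th dense sets can be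
  -- glued.
  obtain ⟨𝒴, h𝒴⟩ := zorn_subset
    {𝒴 : Set (Set X) | 𝒴.PairwiseDisjoint id ∧ ∀ Y ∈ 𝒴, HasDisjointDense Y ι} (by
      intro c hc hchain
      refine ⟨⋃₀ c, ⟨?_, ?_⟩, fun s hs => subset_sUnion_of_mem hs⟩
      · exact (pairwiseDisjoint_sUnion hchain.directedOn).2 fun s hs => (hc hs).1
      · rintro Y ⟨s, hs, hYs⟩
        exact (hc hs).2 Y hYs)
  have hdense : closure (⋃₀ 𝒴) = Set.univ := by
    by_contra hne
    obtain ⟨Y, hYU, hYn, hY⟩ := h (closure (⋃₀ 𝒴))ᶜ isClosed_closure.isOpen_compl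
      (nonempty_compl.2 hne)
    have hdisj : ∀ Z ∈ 𝒴, Disjoint Y Z := fun Z hZ =>
      disjoint_left.2 fun x hxY hxZ => hYU hxY (subset_closure ⟨Z, hZ, hxZ⟩)
    have hmem : insert Y 𝒴 ∈
        {𝒴 : Set (Set X) | 𝒴.PairwiseDisjoint id ∧ ∀ Y ∈ 𝒴, HasDisjointDense Y ι} := by
      refine ⟨h𝒴.prop.1.insert fun Z hZ _ => hdisj Z hZ, ?_⟩
      rintro Z (rfl | hZ)
      · exact hY
      · exact h𝒴.prop.2 Z hZ
    have hY𝒴 : Y ∈ 𝒴 := h𝒴.le_of_ge hmem (subset_insert _ _) (mem_insert _ _)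
    obtain ⟨x, hx⟩ := hYn
    exact disjoint_left.1 (hdisj Y hY𝒴) hx hx
  choose! D hD hDY using h𝒴.prop.2
  refine ⟨fun i => ⋃ Y ∈ 𝒴, D Y i, fun i j hij => ?_, fun i => ⟨subset_univ _, ?_⟩⟩
  · simp only [onFun, disjoint_left, mem_iUnion]
    rintro x ⟨Y, hY, hx⟩ ⟨Z, hZ, hx'⟩
    have hYZ : Y = Z := h𝒴.prop.1.elim_set hY hZ x ((hDY Y hY i).1 hx) ((hDY Z hZ j).1 hx')
    subst hYZ
    exact disjoint_left.1 (hD Y hY hij) hx hx'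
  · rw [← hdense]
    refine closure_minimal (sUnion_subset fun Y hY => ?_) isClosed_closure
    exact (hDY Y hY i).2.trans (closure_mono (subset_biUnion_of_mem (u := fun Y => D Y i) hY))

/-! ### Almost disjoint sets and the regular case. -/

/-- Diagonalisation gives `κ⁺` functions `ι → ι` that pairwise agree at fewer than `κ` places. Their
graphs, carried to `ι` by a bijection `ι × ι ≃ ι`, are almost disjoint. -/
theorem exists_almost_disjoint {κ : Cardinal.{u}} (hκ : ℵ₀ ≤ κ) {ι : Type u} [LinearOrder ι]
    (hι : #ι = κ) (hlt : ∀ a : ι, #(Iic a) < κ) :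
    ∃ A : (Order.succ κ).ord.ToType → Set ι, (∀ j, #(A j) = κ) ∧
      Pairwise fun i j => #(A i ∩ A j : Set ι) < κ := by
  classical
  obtain ⟨g, hg⟩ := exists_greedy (ι := (Order.succ κ).ord.ToType) (X := ι → ι)
    (fun a f x => ∀ b, #{i | x i = f b i} < κ) (by
      intro a f
      have ha : #(Iio a) ≤ #ι := by
        rw [hι, ← Order.lt_succ_iff]
        simpa using mk_Iio_lt a (by simp)
      obtain ⟨e⟩ := ha
      have hex : ∀ i : ι, ∃ y : ι, ∀ b, e b ≤ i → y ≠ f b i := by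
        intro i
        have hlt' : #((fun b => f b i) '' (e ⁻¹' Iic i)) < #ι := by
          refine mk_image_le.trans_lt ?_
          refine (mk_preimage_of_injective e _ e.injective).trans_lt ?_
          rw [hι]
          exact hlt i
        have hne : ((fun b => f b i) '' (e ⁻¹' Iic i)) ≠ Set.univ := by
          intro h
          rw [h, mk_univ] at hlt'
          exact lt_irrefl _ hlt'
        obtain ⟨y, hy⟩ := (ne_univ_iff_exists_notMem _).1 hne
        exact ⟨y, fun b hb h => hy ⟨b, hb, h.symm⟩⟩
      choose y hy using hex
      refine ⟨y, fun b => (mk_le_mk_of_subset ?_).trans_lt (hlt (e b))⟩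
      intro i hi
      by_contra hlt
      exact hy i b (not_le.1 hlt).le hi)
  have hprod : #(ι × ι) = #ι := by
    rw [mk_prod, lift_id, mul_eq_self (hι ▸ hκ)]
  obtain ⟨φ⟩ := Cardinal.eq.1 hprod
  have hinj : ∀ j, Injective fun i => φ (i, g j i) := fun j i i' h =>
    congrArg Prod.fst (φ.injective h)
  have key : ∀ i j, j < i → #(range (fun k => φ (k, g i k)) ∩ range (fun k => φ (k, g j k)) :
      Set ι) < κ := by
    intro i j hij
    refine (mk_le_mk_of_subset (t := (fun k => φ (k, g i k)) '' {k | g i k = g j k}) ?_).trans_lt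
      (mk_image_le.trans_lt (hg i ⟨j, hij⟩))
    rintro _ ⟨⟨k, rfl⟩, ⟨l, hl⟩⟩
    have := φ.injective hl
    simp only [Prod.mk.injEq] at this
    obtain ⟨rfl, h⟩ := this
    exact ⟨l, h.symm, rfl⟩
  refine ⟨fun j => range fun i => φ (i, g j i), fun j => ?_, fun i j hij => ?_⟩
  · rw [mk_range_eq _ (hinj j), hι]
  · rcases hij.lt_or_gt with h | h
    · have := key j i h
      rwa [inter_comm] at this
    · exact key i j h

theorem exists_mem_notMem_of_mk_lt {X : Type*} {A B : Set X} (h : #B < #A) : ∃ x ∈ A, x ∉ B := by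
  by_contra! hAB
  exact (mk_le_mk_of_subset hAB).not_gt h

theorem mk_Iic_lt_of_mk_Iio_lt {ι : Type*} [LinearOrder ι] {κ : Cardinal} (hκ : ℵ₀ ≤ κ) (a : ι)
    (h : #(Iio a) < κ) : #(Iic a) < κ := by
  rw [← Iio_insert]
  exact mk_insert_le.trans_lt (add_lt_of_lt hκ h (one_lt_aleph0.trans_le hκ))

section LeftSeparated

variable {κ : Cardinal.{u}} {ι : Type u} [LinearOrder ι] [WellFoundedLT ι] [TopologicalSpace ι]

/-- The complete accumulation points of a set. -/
def completeAcc (κ : Cardinal.{u}) (A : Set ι) : Set ι := {a | ∀ U ∈ 𝓝 a, κ ≤ #(U ∩ A : Set ι)}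

/-- From `κ` exceptional points one could pick an increasing sequence of length `κ` that avoids the
small neighbourhoods of its earlier terms. Final segments are neighbourhoods, so its range would be
discrete. -/
theorem mk_diff_completeAcc_lt (hκ : κ.IsRegular) (hι : #ι = κ) (hlt : ∀ a : ι, #(Iic a) < κ)
    (hl : ∀ a : ι, Ici a ∈ 𝓝 a) (hnd : ∀ D : Set ι, IsDiscrete D → #D < κ) (A : Set ι) :
    #(A \ completeAcc κ A : Set ι) < κ := by
  by_contra! hA
  set A₀ := A \ completeAcc κ A with hA₀
  have hU : ∀ a ∈ A₀, ∃ U ∈ 𝓝 a, #(U ∩ A : Set ι) < κ := by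
    rintro a ⟨-, ha⟩
    simpa [completeAcc] using ha
  choose! U hUn hUc using hU
  obtain ⟨f, hf⟩ := exists_greedy (ι := ι) (X := ι)
    (fun a f x => x ∈ A₀ ∧ ∀ b, f b ∈ A₀ → f b < x ∧ x ∉ U (f b)) (by
      intro a f
      have hsmall : #(⋃ b : Iio a, {y | f b ∈ A₀ ∧ y ∈ Iic (f b) ∪ U (f b) ∩ A}) < κ := by
        rw [card_iUnion_lt_iff_forall_of_isRegular hκ
          ((mk_le_mk_of_subset Iio_subset_Iic_self).trans_lt (hlt a))]
        intro b
        by_cases hb : f b ∈ A₀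
        · refine (mk_le_mk_of_subset (fun y hy => hy.2)).trans_lt
            ((mk_union_le _ _).trans_lt (add_lt_of_lt hκ.aleph0_le (hlt _) (hUc _ hb)))
        · simpa [hb] using hκ.pos
      obtain ⟨x, hx, hxU⟩ := exists_mem_notMem_of_mk_lt (hsmall.trans_le hA)
      refine ⟨x, hx, fun b hb => ?_⟩
      simp only [mem_iUnion, mem_ofPred_eq, not_exists, not_and] at hxU
      have := hxU b hb
      simp only [mem_union, mem_Iic, mem_inter_iff, not_or, not_le, not_and] at this
      exact ⟨this.1, fun h => this.2 h hx.1⟩)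
  have hdisc := isDiscrete_range_of_forall_nhds (f := f) fun a => by
    refine ⟨U (f a) ∩ Ici (f a), Filter.inter_mem (hUn _ (hf a).1) (hl _), fun b hba hb => ?_⟩
    rcases hba.lt_or_gt with h | h
    · exact ((hf a).2 ⟨b, h⟩ (hf b).1).1.not_ge hb.2
    · exact ((hf b).2 ⟨a, h⟩ (hf a).1).2 hb.1
  have := hnd _ hdisc.1
  rw [mk_range_eq _ hdisc.2, hι] at this
  exact lt_irrefl _ this

theorem exists_hasDisjointDense_of_leftSeparated (hκ : κ.IsRegular) (hι : #ι = κ)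
    (hlt : ∀ a : ι, #(Iic a) < κ) (hl : ∀ a : ι, Ici a ∈ 𝓝 a)
    (hnd : ∀ D : Set ι, IsDiscrete D → #D < κ) :
    ∃ Y : Set ι, Y.Nonempty ∧ HasDisjointDense Y ι := by
  obtain ⟨J, hJκ, A, hAκ, hA⟩ : ∃ J : Type u, κ < #J ∧ ∃ A : J → Set ι,
      (∀ j, #(A j) = κ) ∧ Pairwise fun i j => #(A i ∩ A j : Set ι) < κ :=
    ⟨_, by rw [mk_ord_toType]; exact Order.lt_succ κ, exists_almost_disjoint hκ.aleph0_le hι hlt⟩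
  let idx : ι → Set J := fun x => {j | x ∈ completeAcc κ (A j)}
  -- The subspace sought is `Nᶜ`: its points accumulate more than `κ` of the sets `A j`, and for `j
  -- ∉ bad` the set `A j` is almost contained in it.
  let N : Set ι := {x | #(idx x) ≤ κ}
  let bad : Set J := ⋃ x : N, idx x
  have hbad : #bad ≤ κ := by
    refine (mk_iUnion_le _).trans ?_
    rw [← mul_eq_self hκ.aleph0_le]
    refine mul_le_mul' (hι ▸ mk_set_le N) (ciSup_le' fun x => x.2)
  have hN : ∀ j ∉ bad, #(A j ∩ N : Set ι) < κ := by
    intro j hj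
    refine (mk_le_mk_of_subset ?_).trans_lt (mk_diff_completeAcc_lt hκ hι hlt hl hnd (A j))
    rintro x ⟨hx, hxN⟩
    exact ⟨hx, fun h => hj (mem_iUnion.2 ⟨⟨x, hxN⟩, h⟩)⟩
  obtain ⟨j₀, -, hj₀⟩ := exists_mem_notMem_of_mk_lt (A := Set.univ) (B := bad)
    (by rw [mk_univ]; exact hbad.trans_lt hJκ)
  obtain ⟨y₀, hy₀A, hy₀⟩ := exists_mem_notMem_of_mk_lt (A := A j₀) (B := A j₀ ∩ N)
    (by rw [hAκ]; exact hN j₀ hj₀)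
  have hy₀N : y₀ ∈ Nᶜ := fun h => hy₀ ⟨hy₀A, h⟩
  have hprod : #(ι × (Nᶜ : Set ι)) ≤ #ι := by
    rw [mk_prod, lift_id, lift_id, hι]
    exact (mul_le_mul' le_rfl (hι ▸ mk_set_le _)).trans (mul_eq_self hκ.aleph0_le).le
  obtain ⟨φ⟩ := hprod
  have : Nonempty (ι × (Nᶜ : Set ι)) := ⟨(y₀, ⟨y₀, hy₀N⟩)⟩
  obtain ⟨e, he⟩ : ∃ e : ι → ι × (Nᶜ : Set ι), Surjective e :=
    ⟨invFun φ, invFun_surjective φ.injective⟩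
  obtain ⟨j, hj⟩ := exists_greedy (ι := ι) (X := J)
    (fun a f x => x ∈ idx (e a).2 ∧ x ∉ bad ∧ ∀ b, x ≠ f b) (by
      intro a f
      have hlarge : κ < #(idx (e a).2) := not_le.1 (e a).2.2
      have hsmall : #(bad ∪ range f : Set J) ≤ κ := by
        refine (mk_union_le _ _).trans ?_
        rw [← add_eq_self hκ.aleph0_le]
        exact add_le_add hbad
          (mk_range_le.trans ((mk_le_mk_of_subset Iio_subset_Iic_self).trans (hlt a).le))
      obtain ⟨x, hx, hx'⟩ := exists_mem_notMem_of_mk_lt (hsmall.trans_lt hlarge)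
      exact ⟨x, hx, fun h => hx' (Or.inl h), fun b h => hx' (Or.inr ⟨b, h.symm⟩)⟩)
  -- Only fewer than `κ` points of `A (j a)` are lost, so the point `(e a).2` remains in the closure
  -- of `B a`. Each pair of an index and a point of `Nᶜ` is some `e a`, so the union over each index
  -- is dense.
  let B : ι → Set ι := fun a => (A (j a) ∩ Nᶜ) \ ⋃ b : Iio a, A (j b)
  have hBdisj : ∀ a b x, x ∈ B a → x ∈ B b → a = b := by
    have key : ∀ a b x, x ∈ B a → x ∈ B b → ¬ a < b := fun a b x hxa hxb hab =>
      hxb.2 (mem_iUnion.2 ⟨⟨a, hab⟩, hxa.1.1⟩)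
    exact fun a b x hxa hxb =>
      le_antisymm (not_lt.1 (key b a x hxb hxa)) (not_lt.1 (key a b x hxa hxb))
  refine ⟨Nᶜ, ⟨y₀, hy₀N⟩, fun i => ⋃ a ∈ {a | (e a).1 = i}, B a, fun i i' hii => ?_,
    fun i => ⟨iUnion₂_subset fun a _ x hx => hx.1.2, fun x hx => ?_⟩⟩
  · simp only [onFun, disjoint_left, mem_iUnion]
    rintro x ⟨a, ha, hxa⟩ ⟨b, hb, hxb⟩
    obtain rfl := hBdisj a b x hxa hxb
    exact hii (ha.symm.trans hb)
  · obtain ⟨a, ha⟩ := he (i, ⟨x, hx⟩)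
    rw [mem_closure_iff_nhds]
    intro U hU
    by_contra hempty
    have hacc : κ ≤ #(U ∩ A (j a) : Set ι) := by
      have := (hj a).1
      rw [ha] at this
      exact this U hU
    refine hacc.not_gt ((mk_le_mk_of_subset
      (t := (A (j a) ∩ N) ∪ ⋃ b : Iio a, (A (j a) ∩ A (j b))) ?_).trans_lt
      ((mk_union_le _ _).trans_lt (add_lt_of_lt hκ.aleph0_le (hN _ (hj a).2.1) ?_)))
    · rintro y ⟨hyU, hyA⟩
      by_contra hy
      simp only [mem_union, mem_inter_iff, mem_iUnion, not_or, not_and, not_exists] at hy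
      refine hempty ⟨y, hyU, mem_biUnion (x := a) (by simp [ha]) ⟨⟨hyA, hy.1 hyA⟩, ?_⟩⟩
      simp only [mem_iUnion, not_exists]
      exact fun b => hy.2 b hyA
    · rw [card_iUnion_lt_iff_forall_of_isRegular hκ
        ((mk_le_mk_of_subset Iio_subset_Iic_self).trans_lt (hlt a))]
      exact fun b => hA ((hj a).2.2 b)

end LeftSeparated

theorem exists_hasDisjointDense_of_isRegular {X : Type u} [TopologicalSpace X] [Nonempty X]
    {κ : Cardinal.{u}} (hκ : κ.IsRegular)
    (hΔ : ∀ U : Set X, IsOpen U → U.Nonempty → κ ≤ #U)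
    (hnd : ∀ D : Set X, IsDiscrete D → #D < κ) :
    ∃ Y : Set X, Y.Nonempty ∧ HasDisjointDense Y κ.ord.ToType := by
  have hIio : ∀ a : κ.ord.ToType, #(Iio a) < κ := fun a => by simpa using mk_Iio_lt a (by simp)
  have hIic : ∀ a : κ.ord.ToType, #(Iic a) < κ := fun a =>
    mk_Iic_lt_of_mk_Iio_lt hκ.aleph0_le a (hIio a)
  by_cases h : ∀ Z : Set X, ∃ B ⊆ Z, #B < κ ∧ Z ⊆ closure B
  · refine ⟨Set.univ, univ_nonempty, ?_⟩
    choose d hdZ hdκ hd using h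
    obtain ⟨D, hD⟩ := exists_greedy (ι := κ.ord.ToType) (X := Set X)
      (fun a f x => x = d (⋃ b, f b)ᶜ) fun a f => ⟨_, rfl⟩
    have hDκ : ∀ a, #(D a) < κ := fun a => hD a ▸ hdκ _
    have hDdisj : ∀ a b, a < b → Disjoint (D a) (D b) := fun a b hab => by
      rw [disjoint_left]
      intro x hxa hxb
      rw [hD b] at hxb
      exact hdZ _ hxb (mem_iUnion.2 ⟨⟨a, hab⟩, hxa⟩)
    refine ⟨D, fun a b hab => ?_, fun a => ⟨subset_univ _, ?_⟩⟩
    · rcases hab.lt_or_gt with h | h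
      · exact hDdisj a b h
      · exact (hDdisj b a h).symm
    · have hsmall : #(⋃ b : Iio a, D b) < κ :=
        (card_iUnion_lt_iff_forall_of_isRegular hκ (hIio a)).2 fun b => hDκ b
      have hdense : Dense (⋃ b : Iio a, D b)ᶜ := by
        rw [dense_iff_inter_open]
        intro U hU hUn
        obtain ⟨x, hx, hx'⟩ := exists_mem_notMem_of_mk_lt (hsmall.trans_le (hΔ U hU hUn))
        exact ⟨x, hx, hx'⟩
      rw [← hdense.closure_eq, hD a]
      exact closure_minimal (hd _) isClosed_closure
  · push Not at h
    obtain ⟨Z, hZ⟩ := h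
    -- No earlier term set is dense in `Z`, so each new term avoids the closure of its predecessors:
    -- the sequence is left-separated.
    obtain ⟨f, hf⟩ := exists_greedy (ι := κ.ord.ToType) (X := X)
      (fun a f x => x ∈ Z ∧ ((∀ b, f b ∈ Z) → x ∉ closure (range f))) (by
        intro a f
        by_cases hfZ : ∀ b, f b ∈ Z
        · have hr : range f ⊆ Z := range_subset_iff.2 hfZ
          obtain ⟨x, hx, hx'⟩ := not_subset.1 (hZ _ hr (mk_range_le.trans_lt (hIio a)))
          exact ⟨x, hx, fun _ => hx'⟩
        · have hne : Z.Nonempty := by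
            by_contra hem
            rw [not_nonempty_iff_eq_empty] at hem
            exact hZ ∅ (empty_subset _) (by simpa using hκ.pos) (by simp [hem])
          exact ⟨_, hne.some_mem, fun h => absurd h hfZ⟩)
    have hsep : ∀ a, f a ∉ closure (range fun b : Iio a => f b) := fun a =>
      (hf a).2 fun b => (hf b).1
    have hinj : Injective f := by
      have key : ∀ a b, a < b → f a ≠ f b := fun a b hab h =>
        hsep b (subset_closure ⟨⟨a, hab⟩, h⟩)
      intro a b hab
      rcases lt_trichotomy a b with h | h | h
      · exact absurd hab (key _ _ h)
      · exact h
      · exact absurd hab.symm (key _ _ h)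
    let _ : TopologicalSpace κ.ord.ToType := .induced f inferInstance
    have hemb : IsEmbedding f := ⟨⟨rfl⟩, hinj⟩
    obtain ⟨Y, hYn, hY⟩ := exists_hasDisjointDense_of_leftSeparated hκ (mk_ord_toType κ) hIic
      (fun a => by
        rw [hemb.nhds_eq_comap]
        refine ⟨_, isClosed_closure.isOpen_compl.mem_nhds (hsep a), fun b hb => ?_⟩
        by_contra hba
        exact hb (subset_closure ⟨⟨b, show b < a from not_le.1 hba⟩, rfl⟩))
      (fun D hD => by
        rw [← mk_image_eq hinj]
        exact hnd _ (isDiscrete_image hD hemb))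
    exact ⟨f '' Y, hYn.image f, hY.image hemb⟩

/-! ### Cardinality bounds for Hausdorff spaces. -/

/-- A point of the closure is determined by the subsets of `S` that accumulate at it. -/
theorem mk_closure_le_of_t2 {X : Type u} [TopologicalSpace X] [T2Space X] (S : Set X) :
    #(closure S) ≤ 2 ^ (2 : Cardinal.{u}) ^ #S := by
  rw [← mk_set, ← mk_set]
  let g : closure S → Set (Set S) := fun x => {A | (x : X) ∈ closure (Subtype.val '' A)}
  refine mk_le_of_injective (f := g) fun x y hxy => ?_
  by_contra hne
  obtain ⟨U, V, hU, hV, hxU, hyV, hUV⟩ := t2_separation (fun h => hne (Subtype.ext h))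
  have hx : {s : S | (s : X) ∈ U} ∈ g x := by
    have h : (x : X) ∈ closure (U ∩ S) := hU.inter_closure ⟨hxU, x.2⟩
    refine closure_mono ?_ h
    exact fun z hz => ⟨⟨z, hz.2⟩, hz.1, rfl⟩
  rw [hxy] at hx
  obtain ⟨z, hzV, s, hs, rfl⟩ := mem_closure_iff.1 hx V hV hyV
  exact disjoint_left.1 hUV hs hzV

/-- A Hausdorff space of cardinality greater than `2 ^ τ` is not hereditarily `τ`-Lindelöf. -/
theorem exists_nhds_not_covered {Y : Type u} [TopologicalSpace Y] [T2Space Y] {τ : Cardinal.{u}}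
    (hτ : ℵ₀ ≤ τ) (h : 2 ^ τ < #Y) :
    ∃ (A : Set Y) (V : Y → Set Y), (∀ a ∈ A, V a ∈ 𝓝 a) ∧
      ∀ B ⊆ A, #B ≤ τ → ¬ A ⊆ ⋃ b ∈ B, V b := by
  classical
  by_contra! H
  obtain ⟨T, hT⟩ : ∃ T : Type u, #T = τ := ⟨τ.out, mk_out τ⟩
  -- Covering `{x}ᶜ` by `τ` neighbourhoods disjoint from neighbourhoods of `x` makes `x` an
  -- intersection of `τ` neighbourhoods.
  have hW : ∀ x : Y, ∃ W : T → Set Y, (∀ i, W i ∈ 𝓝 x) ∧ ∀ p, p ≠ x → ∃ i, p ∉ W i := by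
    intro x
    have hsep : ∀ y, y ≠ x → ∃ U ∈ 𝓝 x, ∃ V ∈ 𝓝 y, Disjoint U V := fun y hy => by
      obtain ⟨U, V, hU, hV, hUV⟩ := t2_separation_nhds hy.symm
      exact ⟨U, hU, V, hV, hUV⟩
    choose! U hU V hV hUV using hsep
    obtain ⟨B, hBx, hBτ, hB⟩ := H {x}ᶜ V fun y hy => hV y hy
    rw [← hT] at hBτ
    obtain ⟨φ⟩ := hBτ
    refine ⟨fun i => if h : ∃ b : B, φ b = i then U h.choose else Set.univ, fun i => ?_,
      fun p hp => ?_⟩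
    · dsimp only
      split_ifs with h
      · exact hU _ (hBx h.choose.2)
      · exact Filter.univ_mem
    · obtain ⟨b, hb, hpb⟩ := mem_iUnion₂.1 (hB hp)
      have hex : ∃ b' : B, φ b' = φ ⟨b, hb⟩ := ⟨_, rfl⟩
      refine ⟨φ ⟨b, hb⟩, ?_⟩
      dsimp only
      rw [dif_pos hex, φ.injective hex.choose_spec]
      exact fun hpU => disjoint_left.1 (hUV b (hBx hb)) hpU hpb
  choose W hWn hWp using hW
  have hYne : Nonempty Y := mk_ne_zero_iff.1 (ne_bot_of_gt h)
  obtain ⟨y₀⟩ := hYne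
  have hF : ∀ (c : T → T) (g : T → Y), ∃ y, (∃ p, ∀ t, p ∉ W (g t) (c t)) →
      ∀ t, y ∉ W (g t) (c t) := by
    intro c g
    by_cases hp : ∃ p, ∀ t, p ∉ W (g t) (c t)
    · exact ⟨hp.choose, fun _ => hp.choose_spec⟩
    · exact ⟨y₀, fun h => absurd h hp⟩
  choose F hF using hF
  -- Well-founded trees with leaf `y₀` and `T`-ary nodes `F c` evaluate to a set of size at most `2
  -- ^ τ` closed under every `F c`. For `p` outside it, `τ` many of the sets `W x (i x)`, all
  -- missing `p`, cover the closed set. Yet `F` returns a point of that set outside this cover.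
  let β : Option (T → T) → Type u := fun a => a.elim PEmpty fun _ => T
  let step : (Σ a, β a → Y) → Y := fun s =>
    match s with
    | ⟨none, _⟩ => y₀
    | ⟨some c, g⟩ => F c g
  let ev : WType β → Y := WType.elim Y step
  have hcard : #(range ev) < #Y := by
    refine (mk_range_le.trans (WType.cardinalMk_le_of_le (κ := 2 ^ τ) ?_)).trans_lt h
    refine (sum_le_mk_mul_iSup _).trans ?_
    have h2 : ℵ₀ ≤ (2 : Cardinal.{u}) ^ τ := hτ.trans (cantor τ).le
    refine (mul_le_mul' (?_ : _ ≤ (2 : Cardinal.{u}) ^ τ) (ciSup_le' ?_)).trans (mul_eq_self h2).le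
    · rw [mk_option, ← power_def, hT, power_self_eq hτ]
      exact (add_one_eq h2).le
    · rintro (_ | c)
      · simpa [β] using one_le_aleph0.trans h2
      · change _ ^ #T ≤ _
        rw [hT, ← power_mul, mul_eq_self hτ]
  obtain ⟨p, -, hp⟩ := exists_mem_notMem_of_mk_lt (A := Set.univ) (B := range ev)
    (by rwa [mk_univ])
  have hi : ∀ x ∈ range ev, ∃ i, p ∉ W x i := fun x hx =>
    hWp x p fun h => hp (h ▸ hx)
  have : Nonempty T := mk_ne_zero_iff.1 (hT ▸ (aleph0_pos.trans_le hτ).ne')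
  choose! i hi using hi
  obtain ⟨B, hBR, hBτ, hB⟩ := H (range ev) (fun x => W x (i x)) fun x _ => hWn x _
  have hBne : Nonempty B := by
    obtain ⟨b, hb, -⟩ := mem_iUnion₂.1 (hB ⟨WType.mk none PEmpty.elim, rfl⟩)
    exact ⟨⟨b, hb⟩⟩
  rw [← hT] at hBτ
  obtain ⟨ψ, hs⟩ : ∃ ψ : T → B, Surjective ψ := by
    obtain ⟨φ⟩ := hBτ
    exact ⟨invFun φ, invFun_surjective φ.injective⟩
  choose w hw using fun t => hBR (ψ t).2
  have hnot := hF (fun t => i (ψ t : Y)) (fun t => (ψ t : Y))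
    ⟨p, fun t => hi _ (hBR (ψ t).2)⟩
  have hmem : F (fun t => i (ψ t : Y)) (fun t => (ψ t : Y)) ∈ range ev := by
    refine ⟨WType.mk (some fun t => i (ψ t : Y)) w, ?_⟩
    change F _ (fun t => ev (w t)) = _
    exact congrArg _ (funext hw)
  obtain ⟨b, hb, hFb⟩ := mem_iUnion₂.1 (hB hmem)
  obtain ⟨t, ht⟩ := hs ⟨b, hb⟩
  refine hnot t ?_
  rw [ht]
  exact hFb

/-- The closure of `τ` points has size at most `2 ^ 2 ^ τ`, so its neighbourhoods `V` do not cover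
`A`. Each new point can thus avoid both the earlier `V` and the closure of the earlier points. -/
theorem exists_isDiscrete_of_two_power_lt {Y : Type u} [TopologicalSpace Y] [T2Space Y]
    {τ : Cardinal.{u}} (hτ : ℵ₀ ≤ τ) (h : (2 : Cardinal.{u}) ^ (2 : Cardinal.{u}) ^
      (2 : Cardinal.{u}) ^ τ < #Y) :
    ∃ D : Set Y, IsDiscrete D ∧ τ < #D := by
  obtain ⟨A, V, hV, hA⟩ := exists_nhds_not_covered
    (hτ.trans ((cantor τ).le.trans (cantor _).le)) h
  obtain ⟨f, hf⟩ := exists_greedy (ι := (Order.succ τ).ord.ToType) (X := Y)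
    (fun a f x => x ∈ A ∧ (∀ b, f b ∈ A → x ∉ V (f b)) ∧ x ∉ closure (range f)) (by
      intro a f
      have ha : #(range f) ≤ τ := mk_range_le.trans (by
        rw [← Order.lt_succ_iff]
        simpa using mk_Iio_lt a (by simp))
      obtain ⟨x, hx, hxV⟩ := not_subset.1 (hA (closure (range f) ∩ A) inter_subset_right
        ((mk_le_mk_of_subset inter_subset_left).trans ((mk_closure_le_of_t2 _).trans
          (power_le_power_left two_ne_zero (power_le_power_left two_ne_zero ha)))))
      simp only [mem_iUnion, not_exists] at hxV
      exact ⟨x, hx, fun b hb => hxV _ ⟨subset_closure ⟨b, rfl⟩, hb⟩,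
        fun hcl => hxV x ⟨hcl, hx⟩ (mem_of_mem_nhds (hV x hx))⟩)
  have hdisc := isDiscrete_range_of_forall_nhds (f := f) fun a => by
    refine ⟨V (f a) ∩ (closure (range fun b : Iio a => f b))ᶜ, Filter.inter_mem (hV _ (hf a).1)
      (isClosed_closure.isOpen_compl.mem_nhds (hf a).2.2), fun b hba hb => ?_⟩
    rcases hba.lt_or_gt with h | h
    · exact hb.2 (subset_closure ⟨⟨b, h⟩, rfl⟩)
    · exact (hf b).2.1 ⟨a, h⟩ (hf a).1 hb.1
  refine ⟨_, hdisc.1, ?_⟩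
  rw [mk_range_eq _ hdisc.2, mk_ord_toType]
  exact Order.lt_succ τ

/-! ### Discrete sets of singular strong limit size. -/

theorem sum_lt_of_lt_cof {ι : Type u} {l : Cardinal.{u}} (hl : ℵ₀ ≤ l) (hι : #ι < l.ord.cof)
    {f : ι → Cardinal.{u}} (hf : ∀ i, f i < l) : sum f < l :=
  (sum_le_mk_mul_iSup f).trans_lt
    (mul_lt_of_lt hl (hι.trans_le (Ordinal.cof_ord_le l)) (iSup_lt_of_lt_cof_ord hι hf))

theorem exists_cofinal_cardinals (l : Cardinal.{u}) :
    ∃ c : l.ord.cof.ord.ToType → Cardinal.{u}, (∀ i, c i < l) ∧ ∀ d < l, ∃ i, d ≤ c i := by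
  obtain ⟨s, hs, hsl⟩ := Order.exists_cof_eq l.ord.ToType
  rw [Ordinal.cof_toType, ← mk_ord_toType l.ord.cof] at hsl
  obtain ⟨e⟩ := Cardinal.eq.1 hsl
  refine ⟨fun i => #(Iio (e.symm i : l.ord.ToType)), fun i => ?_, fun d hd => ?_⟩
  · simpa using mk_Iio_lt (e.symm i : l.ord.ToType) (by simp)
  · have hd' : d.ord < Ordinal.type (α := l.ord.ToType) (· < ·) := by simpa using hd
    let x : l.ord.ToType := Ordinal.enum (α := l.ord.ToType) (· < ·) ⟨d.ord, hd'⟩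
    obtain ⟨y, hy, hxy⟩ := hs x
    refine ⟨e ⟨y, hy⟩, ?_⟩
    simp only [e.symm_apply_apply]
    have hx : #(Iio x) = d := (congrArg Ordinal.card
      (Ordinal.typein_enum (α := l.ord.ToType) (· < ·) hd')).trans (card_ord d)
    rw [← hx]
    exact mk_le_mk_of_subset (Iio_subset_Iio hxy)

/-- The gap between `σ i` and the regular `ν i` leaves room for the pigeonhole on subsets of a set
of size `σ i`, for closures, and for `exists_isDiscrete_of_two_power_lt`. -/
theorem exists_fast_growing {l : Cardinal.{u}} (hl : l.IsSingular) (hs : l.IsStrongLimit) :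
    ∃ σ ν : l.ord.cof.ord.ToType → Cardinal.{u}, (∀ i, ν i < l) ∧ (∀ i, ℵ₀ ≤ σ i) ∧
      (∀ i, l.ord.cof ≤ σ i) ∧ (∀ i, sum (fun j : Iio i => ν j) ≤ σ i) ∧
      (∀ i, ν i = Order.succ (2 ^ (2 : Cardinal.{u}) ^ (2 : Cardinal.{u}) ^
        (2 : Cardinal.{u}) ^ σ i)) ∧ ∀ d < l, ∃ i, d ≤ σ i := by
  obtain ⟨c, hc, hcof⟩ := exists_cofinal_cardinals l
  have hal : ℵ₀ < l := hl.aleph0_le.lt_of_ne fun h => not_isSingular_aleph0 (h ▸ hl)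
  let F : ∀ i : l.ord.cof.ord.ToType, (Iio i → Cardinal.{u}) → Cardinal.{u} := fun i f =>
    max (max ℵ₀ l.ord.cof) (max (sum f) (c i))
  obtain ⟨ν, hν⟩ := exists_greedy (ι := l.ord.cof.ord.ToType) (X := Cardinal.{u})
    (fun i f x => x = Order.succ (2 ^ (2 : Cardinal.{u}) ^ (2 : Cardinal.{u}) ^
        (2 : Cardinal.{u}) ^ F i f)) fun i f => ⟨_, rfl⟩
  refine ⟨fun i => F i fun j => ν j, ν, fun i => ?_,
    fun i => (le_max_left _ _).trans' (le_max_left _ _),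
    fun i => (le_max_left _ _).trans' (le_max_right _ _),
    fun i => (le_max_right _ _).trans' (le_max_left _ _), hν, fun d hd => ?_⟩
  · induction i using WellFoundedLT.induction with
    | ind i ih =>
      rw [hν i]
      refine hs.isSuccLimit.succ_lt ?_
      refine hs.isStrongPrelimit <| hs.isStrongPrelimit <| hs.isStrongPrelimit <|
        hs.isStrongPrelimit ?_
      refine max_lt (max_lt hal hl.cof_ord_lt) (max_lt ?_ (hc i))
      refine sum_lt_of_lt_cof hl.aleph0_le ?_ fun j => ih j j.2
      simpa using mk_Iio_lt i (by simp)
  · obtain ⟨i, hi⟩ := hcof d hd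
    exact ⟨i, hi.trans ((le_max_right _ _).trans (le_max_right _ _))⟩

theorem exists_symmetric_separation (X : Type*) [TopologicalSpace X] [T2Space X] :
    ∃ U : X → X → Set X, ∀ x y, x ≠ y → U x y ∈ 𝓝 x ∧ Disjoint (U x y) (U y x) := by
  have h : ∀ x y : X, ∃ U V : Set X, x ≠ y → U ∈ 𝓝 x ∧ V ∈ 𝓝 y ∧ Disjoint U V := by
    intro x y
    by_cases hxy : x = y
    · exact ⟨∅, ∅, fun h => absurd hxy h⟩
    · obtain ⟨U, V, h⟩ := t2_separation_nhds hxy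
      exact ⟨U, V, fun _ => h⟩
  choose U V h using h
  exact ⟨fun x y => U x y ∩ V y x, fun x y hxy =>
    ⟨Filter.inter_mem (h x y hxy).1 (h y x hxy.symm).2.1,
      (h x y hxy).2.2.mono inter_subset_left inter_subset_right⟩⟩

/-- Let `Q i` be nonempty sets that, for `j > i`, are not split by the sets `U x y` with
`x, y ∈ Q i`. Then few points of `Q i` lack a neighbourhood that misses all later `Q j`. -/
theorem mk_forall_nhds_meet_le {X ι : Type u} [TopologicalSpace X] [LT ι] {U : X → X → Set X}
    (hU : ∀ x y, x ≠ y → U x y ∈ 𝓝 x ∧ Disjoint (U x y) (U y x)) {Q : ι → Set X}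
    (hne : ∀ i, (Q i).Nonempty) {i : ι}
    (hQ : ∀ j, i < j → ∀ x ∈ Q i, ∀ y ∈ Q i, ∀ z ∈ Q j, ∀ z' ∈ Q j, z ∈ U x y → z' ∈ U x y) :
    #{x ∈ Q i | ¬ ∃ O ∈ 𝓝 x, ∀ j, i < j → Disjoint O (Q j)} ≤ 2 ^ (2 : Cardinal.{u}) ^ #ι := by
  rw [← mk_set, ← mk_set]
  -- If `x ≠ y` had the same `g`, it would contain both `{j | Q j ⊆ U x y}` and `{j | Q j ⊆ U y x}`.
  -- These are disjoint, so some neighbourhood of `x` would miss every later `Q j`.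
  let g : {x ∈ Q i | ¬ ∃ O ∈ 𝓝 x, ∀ j, i < j → Disjoint O (Q j)} → Set (Set ι) := fun x =>
    {K | ∃ O ∈ 𝓝 (x : X), ∀ j, i < j → j ∉ K → Disjoint O (Q j)}
  refine mk_le_of_injective (f := g) fun ⟨x, hx, hxO⟩ ⟨y, hy, hyO⟩ hxy => ?_
  by_contra hne'
  have hne' : x ≠ y := fun h => hne' (Subtype.ext h)
  have key : ∀ x ∈ Q i, ∀ y ∈ Q i, ∀ j, i < j → j ∉ {j | Q j ⊆ U x y} →
      Disjoint (U x y) (Q j) := by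
    intro x hx y hy j hij hj
    rw [disjoint_left]
    exact fun z hzU hz => hj fun z' hz' => hQ j hij x hx y hy z hz z' hz' hzU
  have h1 : {j | Q j ⊆ U x y} ∈ g ⟨x, hx, hxO⟩ := ⟨_, (hU x y hne').1, key x hx y hy⟩
  have h2 : {j | Q j ⊆ U y x} ∈ g ⟨y, hy, hyO⟩ := ⟨_, (hU y x hne'.symm).1, key y hy x hx⟩
  rw [← hxy] at h2
  obtain ⟨O₁, hO₁, h1⟩ := h1
  obtain ⟨O₂, hO₂, h2⟩ := h2
  refine hxO ⟨O₁ ∩ O₂, Filter.inter_mem hO₁ hO₂, fun j hij => ?_⟩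
  by_cases hj : Q j ⊆ U x y
  · refine (h2 j hij fun hj' => ?_).mono_left inter_subset_right
    obtain ⟨z, hz⟩ := hne j
    exact disjoint_left.1 (hU x y hne').2 (hj hz) (hj' hz)
  · exact (h1 j hij hj).mono_left inter_subset_left

/-- A Hausdorff space of cardinality at least a singular strong limit cardinal `l` has a discrete
subset of cardinality at least `l`. -/
theorem exists_isDiscrete_of_isSingular {X : Type u} [TopologicalSpace X] [T2Space X]
    {l : Cardinal.{u}} (hl : l.IsSingular) (hs : l.IsStrongLimit) (hX : l ≤ #X) :
    ∃ D : Set X, IsDiscrete D ∧ l ≤ #D := by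
  obtain ⟨U, hU⟩ := exists_symmetric_separation X
  obtain ⟨σ, ν, hνl, hσ, hσcof, hsum, hν, hσl⟩ := exists_fast_growing hl hs
  let ι := l.ord.cof.ord.ToType
  have hιcard : #ι = l.ord.cof := mk_ord_toType _
  have hP : ∀ i, ∃ P : Set X, #P = ν i := fun i =>
    le_mk_iff_exists_set.1 ((hνl i).le.trans hX)
  choose P hP using hP
  let S : ι → Set X := fun i => ⋃ j : Iio i, P j
  have hS : ∀ i, #(S i) ≤ σ i := fun i => by
    refine mk_iUnion_le_sum_mk.trans (le_trans (le_of_eq ?_) (hsum i))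
    exact congrArg sum (funext fun j => hP j)
  have hPS : ∀ i j, i < j → P i ⊆ S j := fun i j hij =>
    subset_iUnion (fun k : Iio j => P k) ⟨i, hij⟩
  have hσ1 : ∀ i, σ i ≤ 2 ^ σ i := fun i => (cantor _).le
  have hσ2 : ∀ i, (2 : Cardinal.{u}) ^ σ i ≤ 2 ^ (2 : Cardinal.{u}) ^ σ i := fun i => (cantor _).le
  have hσ3 : ∀ i, (2 : Cardinal.{u}) ^ (2 : Cardinal.{u}) ^ σ i ≤
    2 ^ (2 : Cardinal.{u}) ^ (2 : Cardinal.{u}) ^ σ i := fun i => (cantor _).le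
  have hσ4 : ∀ i, 2 ^ (2 : Cardinal.{u}) ^ (2 : Cardinal.{u}) ^ σ i < ν i := fun i => by
    rw [hν i]
    exact (cantor _).trans (Order.lt_succ _)
  have hνreg : ∀ i, (ν i).IsRegular := fun i => by
    rw [hν i]
    exact isRegular_succ ((hσ i).trans ((hσ1 i).trans ((hσ2 i).trans
      ((hσ3 i).trans (cantor _).le))))
  -- Thin out `P i` so that its points lie in the same sets `U x y` for all earlier `x` and `y`.
  have hQ : ∀ i, ∃ Q ⊆ P i, #Q = ν i ∧
      ∀ x ∈ S i, ∀ y ∈ S i, ∀ z ∈ Q, ∀ z' ∈ Q, z ∈ U x y → z' ∈ U x y := by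
    intro i
    obtain ⟨a, Q, hQP, hQν, hQ⟩ := infinite_pigeonhole_set (s := P i)
      (fun z => {p : S i × S i | (z : X) ∈ U p.1 p.2}) (ν i) (hP i).ge (hνreg i).aleph0_le (by
        rw [(hνreg i).cof_ord, mk_set, mk_prod, lift_id]
        refine (power_le_power_left two_ne_zero ((mul_le_mul' (hS i) (hS i)).trans
          (mul_eq_self (hσ i)).le)).trans_lt ?_
        exact ((hσ2 i).trans (hσ3 i)).trans_lt (hσ4 i))
    refine ⟨Q, hQP, le_antisymm ((mk_le_mk_of_subset hQP).trans (hP i).le) hQν, ?_⟩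
    intro x hx y hy z hz z' hz' hzU
    have h1 : (⟨x, hx⟩, ⟨y, hy⟩) ∈ {p : S i × S i | z ∈ U p.1 p.2} := hzU
    rw [(hQ hz).trans (hQ hz').symm] at h1
    exact h1
  choose Q hQP hQν hQ using hQ
  let R : ι → Set X := fun i => {x ∈ Q i | ¬ ∃ O ∈ 𝓝 x, ∀ j, i < j → Disjoint O (Q j)}
  have hQne : ∀ i, (Q i).Nonempty := fun i => by
    rw [← nonempty_coe_sort, ← mk_ne_zero_iff, hQν i]
    exact (hνreg i).ne_zero
  have hR : ∀ i, #(R i) ≤ 2 ^ (2 : Cardinal.{u}) ^ σ i := fun i =>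
    (mk_forall_nhds_meet_le hU hQne fun j hij x hx y hy =>
      hQ j x (hPS i j hij (hQP i hx)) y (hPS i j hij (hQP i hy))).trans
      (power_le_power_left two_ne_zero (power_le_power_left two_ne_zero (hιcard.le.trans (hσcof i))))
  have hcl : ∀ i, #(closure (S i)) ≤ 2 ^ (2 : Cardinal.{u}) ^ σ i := fun i =>
    (mk_closure_le_of_t2 _).trans
      (power_le_power_left two_ne_zero (power_le_power_left two_ne_zero (hS i)))
  -- Discarding `R i` separates a point from later blocks, and discarding `closure (S i)` from
  -- earlier ones, so the union of the `D i` is discrete.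
  have hD : ∀ i, ∃ D ⊆ (Q i \ R i) \ closure (S i), IsDiscrete D ∧ σ i < #D := by
    intro i
    have hZ : 2 ^ (2 : Cardinal.{u}) ^ (2 : Cardinal.{u}) ^ σ i <
        #((Q i \ R i) \ closure (S i) : Set X) := by
      by_contra! hle
      have hinf := ((hσ i).trans (hσ1 i)).trans ((hσ2 i).trans (hσ3 i))
      have hsub : Q i ⊆ ((Q i \ R i) \ closure (S i)) ∪ (R i ∪ closure (S i)) := by
        intro x hx
        by_cases h1 : x ∈ R i
        · exact Or.inr (Or.inl h1)
        · by_cases h2 : x ∈ closure (S i)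
          · exact Or.inr (Or.inr h2)
          · exact Or.inl ⟨⟨hx, h1⟩, h2⟩
      refine (hσ4 i).not_ge ?_
      rw [← hQν i]
      refine (mk_le_mk_of_subset hsub).trans ((mk_union_le _ _).trans ?_)
      refine add_le_of_le hinf hle ((mk_union_le _ _).trans ?_)
      exact add_le_of_le hinf ((hR i).trans (hσ3 i)) ((hcl i).trans (hσ3 i))
    obtain ⟨D, hD, hDσ⟩ := exists_isDiscrete_of_two_power_lt (hσ i) hZ
    refine ⟨Subtype.val '' D, Subtype.coe_image_subset _ _, isDiscrete_image hD .subtypeVal, ?_⟩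
    rwa [mk_image_eq Subtype.val_injective]
  choose D hDZ hD hDσ using hD
  refine ⟨⋃ i, D i, isDiscrete_of_forall_nhds fun x hx => ?_, ?_⟩
  · obtain ⟨i, hxi⟩ := mem_iUnion.1 hx
    obtain ⟨⟨hxQ, hxR⟩, hxS⟩ := hDZ i hxi
    obtain ⟨O, hO, hOQ⟩ : ∃ O ∈ 𝓝 x, ∀ j, i < j → Disjoint O (Q j) := by
      by_contra h
      exact hxR ⟨hxQ, h⟩
    obtain ⟨V, hV, hVD⟩ := isDiscrete_iff_forall_mem_exists_isOpen.1 (hD i) x hxi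
    refine ⟨V ∩ (O ∩ (closure (S i))ᶜ), Filter.inter_mem (hV.mem_nhds (hVD.ge rfl).1)
      (Filter.inter_mem hO (isClosed_closure.isOpen_compl.mem_nhds hxS)), ?_⟩
    rintro y hy ⟨hyV, hyO, hyS⟩
    obtain ⟨j, hyj⟩ := mem_iUnion.1 hy
    have hyQ : y ∈ Q j := (hDZ j hyj).1.1
    rcases lt_trichotomy i j with h | rfl | h
    · exact absurd hyQ (disjoint_left.1 (hOQ j h) hyO)
    · exact hVD.le ⟨hyV, hyj⟩
    · exact absurd (subset_closure (hPS j i h (hQP j hyQ))) hyS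
  · by_contra! hlt
    obtain ⟨i, hi⟩ := hσl _ hlt
    exact (hi.trans_lt (hDσ i)).not_ge (mk_le_mk_of_subset (subset_iUnion D i))

/-! ### Equivalence of the two set-theoretic assumptions. -/

theorem isStrongLimit_of_two_power_eq_succ_iterate
    (h : ∀ κ : Cardinal.{u}, ℵ₀ ≤ κ → ∃ n : ℕ, 2 ^ κ = Order.succ^[n] κ)
    {μ : Cardinal.{u}} (hμ : μ.IsSingular) : μ.IsStrongLimit := by
  refine ⟨hμ.pos.ne', fun x hx => ?_⟩
  rcases lt_or_ge x ℵ₀ with hx' | hx'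
  · exact (power_lt_aleph0 (by simp) hx').trans_le hμ.aleph0_le
  · obtain ⟨n, hn⟩ := h x hx'
    rw [hn]
    clear hn
    induction n with
    | zero => exact hx
    | succ n ih =>
      rw [iterate_succ_apply']
      exact hμ.isSuccLimit.succ_lt ih

/-- The supremum is uncountable, not attained and has countable cofinality. -/
theorem isSingular_iSup_succ_iterate {κ : Cardinal.{u}} (hκ : ℵ₀ ≤ κ) :
    (⨆ n : ULift.{u} ℕ, Order.succ^[n.down] κ).IsSingular := by
  have hle : ∀ n : ℕ, Order.succ^[n] κ ≤ ⨆ n : ULift.{u} ℕ, Order.succ^[n.down] κ := fun n =>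
    le_ciSup (f := fun n : ULift.{u} ℕ => Order.succ^[n.down] κ) bddAbove_of_small ⟨n⟩
  have hlt : ∀ n : ℕ, Order.succ^[n] κ < ⨆ n : ULift.{u} ℕ, Order.succ^[n.down] κ := fun n =>
    (Order.lt_succ _).trans_le (by simpa only [iterate_succ_apply'] using hle (n + 1))
  refine .of_not_isRegular (hκ.trans (hle 0)) fun hreg => ?_
  refine lt_irrefl _ (iSup_lt_of_lt_cof_ord ?_ fun n : ULift.{u} ℕ => hlt n.down)
  rw [hreg.cof_ord, mk_uLift, mk_nat, lift_aleph0]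
  exact hκ.trans_lt (hlt 0)

theorem exists_two_power_eq_succ_iterate
    (h : ∀ μ : Cardinal.{u}, μ.IsSingular → μ.IsStrongLimit) {κ : Cardinal.{u}} (hκ : ℵ₀ ≤ κ) :
    ∃ n : ℕ, 2 ^ κ = Order.succ^[n] κ := by
  by_contra! hne
  have hlt : ∀ n : ℕ, Order.succ^[n] κ < 2 ^ κ := by
    intro n
    induction n with
    | zero => exact cantor κ
    | succ n ih =>
      refine lt_of_le_of_ne ?_ (hne _).symm
      rw [iterate_succ_apply']
      exact Order.succ_le_of_lt ih
  have hκμ : κ < ⨆ n : ULift.{u} ℕ, Order.succ^[n.down] κ :=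
    (Order.lt_succ κ).trans_le
      (le_ciSup (f := fun n : ULift.{u} ℕ => Order.succ^[n.down] κ) bddAbove_of_small ⟨1⟩)
  have := (h _ (isSingular_iSup_succ_iterate hκ)).isStrongPrelimit hκμ
  exact this.not_ge (ciSup_le' fun n => (hlt n.down).le)

/-! ### Assembly of maximal resolvability. -/

theorem mk_lt_hatSpread {X : Type u} [TopologicalSpace X] {D : Set X} (hD : IsDiscrete D) :
    #D < hatSpread X := by
  by_contra! h
  obtain ⟨E, hED, hE⟩ := le_mk_iff_exists_subset.1 h
  exact (hatSpread_mem X).2 E (hD.mono hED) hE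

/-- For empty `X` the dispersion character is `sInf ∅ = 0`, below the uncountable `hatSpread X`. -/
theorem nonempty_of_hatSpread_le {X : Type u} [TopologicalSpace X]
    (h : hatSpread X ≤ dispersionCharacter X) : Nonempty X := by
  by_contra hX
  have hpos := aleph0_pos.trans ((hatSpread_mem X).1.trans_le h)
  have hempty : {c | ∃ G : Set X, IsOpen G ∧ G.Nonempty ∧ #G = c} = ∅ := by
    ext c
    simp only [mem_ofPred_eq, mem_empty_iff_false, iff_false]
    rintro ⟨G, -, ⟨x, -⟩, -⟩
    exact hX ⟨x⟩
  rw [dispersionCharacter, hempty, Cardinal.sInf_empty] at hpos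
  exact lt_irrefl _ hpos

theorem exists_minimal_open {X : Type u} [TopologicalSpace X] {U : Set X} (hU : IsOpen U)
    (hUn : U.Nonempty) : ∃ V ⊆ U, IsOpen V ∧ V.Nonempty ∧
      ∀ W ⊆ V, IsOpen W → W.Nonempty → #V ≤ #W := by
  obtain ⟨V, ⟨hVU, hV, hVn⟩, hmin⟩ := (wellFounded_lt (α := Cardinal.{u})).onFun.has_min
    (r := fun V W : Set X => #V < #W) {V | V ⊆ U ∧ IsOpen V ∧ V.Nonempty} ⟨U, subset_rfl, hU, hUn⟩
  exact ⟨V, hVU, hV, hVn, fun W hWV hW hWn => not_lt.1 (hmin W ⟨hWV.trans hVU, hW, hWn⟩)⟩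

theorem isMaximallyResolvable_of_isSingular_imp
    (hs : ∀ μ : Cardinal.{u}, μ.IsSingular → μ.IsStrongLimit)
    (X : Type u) [TopologicalSpace X] [T2Space X]
    (h : hatSpread X ≤ dispersionCharacter X) : IsMaximallyResolvable X := by
  have hX : Nonempty X := nonempty_of_hatSpread_le h
  obtain ⟨D, hD, hDX⟩ : HasDisjointDense (Set.univ : Set X)
      (dispersionCharacter X).ord.ToType := by
    refine hasDisjointDense_univ_of_forall_isOpen fun U hU hUn => ?_
    obtain ⟨V, hVU, hV, hVn, hmin⟩ := exists_minimal_open hU hUn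
    have hΔV : dispersionCharacter X ≤ #V := csInf_le' ⟨V, hV, hVn, rfl⟩
    have hnd : ∀ D : Set V, IsDiscrete D → #D < #V := fun D hD => by
      rw [← mk_image_eq (s := D) Subtype.val_injective]
      exact (mk_lt_hatSpread (isDiscrete_image hD .subtypeVal)).trans_le (h.trans hΔV)
    have hreg : (#V).IsRegular := by
      refine .of_not_isSingular ((hatSpread_mem X).1.le.trans (h.trans hΔV)) fun hsing => ?_
      obtain ⟨D, hD, hle⟩ := exists_isDiscrete_of_isSingular hsing (hs _ hsing) le_rfl
      exact (hnd D hD).not_ge hle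
    have : Nonempty V := hVn.to_subtype
    obtain ⟨Y, hYn, hY⟩ := exists_hasDisjointDense_of_isRegular hreg (fun W hW hWn => by
      rw [← mk_image_eq (s := W) Subtype.val_injective]
      exact hmin _ (Subtype.coe_image_subset _ _) (hV.isOpenMap_subtype_val W hW)
        (hWn.image _)) hnd
    have hle : #(dispersionCharacter X).ord.ToType ≤ #(#V).ord.ToType := by
      rwa [mk_ord_toType, mk_ord_toType]
    obtain ⟨e⟩ := hle
    exact ⟨Subtype.val '' Y, (Subtype.coe_image_subset _ _).trans hVU, hYn.image _,
      (hY.comp e).image .subtypeVal⟩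
  have hdense : ∀ i, Dense (D i) := fun i x => (hDX i).2 (mem_univ x)
  have hinj : Injective D := fun i j hij => by
    by_contra hne
    obtain ⟨x, hx⟩ := (hdense i).nonempty
    exact disjoint_left.1 (hD hne) hx (hij ▸ hx)
  refine ⟨range D, ?_, ?_, ?_⟩
  · rw [mk_range_eq _ hinj, mk_ord_toType]
  · rintro _ ⟨i, rfl⟩
    exact hdense i
  · rintro _ ⟨i, rfl⟩ _ ⟨j, rfl⟩ hij
    exact hD fun h => hij (congrArg D h)

end MaxResolvable

theorem mainTheorem5 :
    ((∀ κ : Cardinal.{u}, ℵ₀ ≤ κ → ∃ n : ℕ, 2 ^ κ = Order.succ^[n] κ) ↔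
      (∀ μ : Cardinal.{u}, μ.IsSingular → μ.IsStrongLimit)) ∧
    ((∀ κ : Cardinal.{u}, ℵ₀ ≤ κ → ∃ n : ℕ, 2 ^ κ = Order.succ^[n] κ) →
      ∀ (X : Type u) [TopologicalSpace X] [T2Space X],
        hatSpread X ≤ dispersionCharacter X → IsMaximallyResolvable X) :=
  ⟨⟨fun h _ => MaxResolvable.isStrongLimit_of_two_power_eq_succ_iterate h,
    fun h _ => MaxResolvable.exists_two_power_eq_succ_iterate h⟩,
    fun h => MaxResolvable.isMaximallyResolvable_of_isSingular_imp
      fun _ => MaxResolvable.isStrongLimit_of_two_power_eq_succ_iterate h⟩
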